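/- Let $\mathbf X=(X,d,D,\alpha)$ be a computable complete metric space: $(X,d)$ is a complete metric space, $D\subseteq X$ is a countable dense set enumerated by $\alpha:\mathbb N\to D$, and the real numbers $d(\alpha(i),\alpha(j))$ are computable uniformly in $i,j$. Let $\mathcal M(\mathbf X)$ be the space of Borel probability measures over $X$ with the Prokhorov distance; its canonical enumerated dense set consists of the probability measures concentrated on finitely many points of $D$ with rational values. A function $f:X\times\mathcal M(\mathbf X)\to[0,\infty]$ is lower semicomputable if, uniformly in rational $r$, the set $\{(x,\mu): f(x,\mu)>r\}$ is the union of a recursively enumerable family of products $B\times B'$, where $B\subseteq X$ and $B'\subseteq\mathcal M(\mathbf X)$ are open balls with rational radii around points of the respective enumerated dense sets. A uniform test of randomness is a lower semicomputable function $(x,\mu)\mapsto t_\mu(x)\in[0,\infty]$ on $X\times\mathcal M(\mathbf X)$ such that $\int t_\mu(x)\,\mu(dx)\le 1$ for every $\mu\in\mathcal M(\mathbf X)$; it is universal if for every uniform test $s$ there is a constant $c>0$ with $s_\mu(x)\le c\,t_\mu(x)$ for all $x,\mu$. Theorem (Levin). Let $t$ be a universal uniform test over $\mathbf X$. If $X$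 is compact, then there is a neutral measure over $\mathbf X$, that is, a probability measure $M\in\mathcal M(\mathbf X)$ with $t_M(x)\le 1$ for every $x\in X$. -/

import Mathlib

open MeasureTheory
open scoped ENNReal NNReal

noncomputable section

namespace UniformRandomness

/-- The nonnegative rational number `a / (b + 1)` with code `(a, b)`. -/
def codedRat (q : ℕ × ℕ) : ℝ≥0 := (q.1 : ℝ≥0) / ((q.2 : ℝ≥0) + 1)

/-- A computable complete metric space structure `(X, d, D, α)` on the metric space `X`: it is
complete, `D = Set.range α` is dense, and the real numbers `d (α i) (α j)` are computable
uniformly in `i, j`. -/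
structure ComputableMetricSpace (X : Type*) [MetricSpace X] where
  /-- the enumeration of the countable dense set -/
  α : ℕ → X
  complete : CompleteSpace X
  dense : DenseRange α
  computable_dist : ∃ g : ℕ × ℕ × ℕ → ℕ × ℕ, Computable g ∧
    ∀ i j n : ℕ, |dist (α i) (α j) - (codedRat (g (i, j, n)) : ℝ)| < 1 / ((n : ℝ) + 1)

/-- Let `B : ι → Set Y` be a numbered basis of open sets of a space `Y`. A function
`f : Y → [0, ∞]` is lower semicomputable if the sets `{y | r < f y}`, for rational `r ≥ 0`, are
unions of basis sets which can be recursively enumerated uniformly in `r`. (For `r < 0` the set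
is the whole space.) -/
def LowerSemicomputable {ι Y : Type*} [Primcodable ι] (B : ι → Set Y) (f : Y → ℝ≥0∞) : Prop :=
  ∃ G : ι × (ℕ × ℕ) → Prop, REPred G ∧
    ∀ q : ℕ × ℕ, {y : Y | (codedRat q : ℝ≥0∞) < f y} = ⋃ i ∈ {i : ι | G (i, q)}, B i

/-- Codes for finite rational convex combinations of point masses: a nonempty list, given by its
head and its tail, of pairs `(i, w)`. -/
abbrev MeasureCode : Type := (ℕ × ℕ) × List (ℕ × ℕ)

namespace ComputableMetricSpace

variable {X : Type*} [MetricSpace X]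

/-- The ideal balls of `X`: the code `(i, q)` stands for the open ball with center `α i` and
radius the rational number with code `q`. -/
def idealBall (S : ComputableMetricSpace X) (b : ℕ × (ℕ × ℕ)) : Set X :=
  Metric.ball (S.α b.1) (codedRat b.2 : ℝ)

variable [MeasurableSpace X]

/-- The combination of the point masses at `α i` with coefficients proportional to `w + 1`, over
the entries `(i, w)` of the nonempty list `c.1 :: c.2`, normalized to have total mass `1`. -/
def idealMeasureAux (S : ComputableMetricSpace X) (c : MeasureCode) : Measure X :=
  (((c.1 :: c.2).map fun a => ((a.2 : ℝ≥0∞) + 1)).sum)⁻¹ •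
    ((c.1 :: c.2).map fun a => ((a.2 : ℝ≥0∞) + 1) • Measure.dirac (S.α a.1)).sum

theorem idealMeasureAux_univ (S : ComputableMetricSpace X) (c : MeasureCode) :
    S.idealMeasureAux c Set.univ = 1 := by
  have key : ∀ l : List (ℕ × ℕ),
      ((l.map fun a => ((a.2 : ℝ≥0∞) + 1) • Measure.dirac (S.α a.1)).sum) Set.univ
        = (l.map fun a => ((a.2 : ℝ≥0∞) + 1)).sum := by
    intro l
    induction l with
    | nil => simp
    | cons a l ih => simp [ih]
  have fin : ∀ l : List (ℕ × ℕ), (l.map fun a => ((a.2 : ℝ≥0∞) + 1)).sum ≠ ⊤ := by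
    intro l
    induction l with
    | nil => simp
    | cons a l ih => simpa using ih
  unfold idealMeasureAux
  rw [Measure.smul_apply, key, smul_eq_mul]
  exact ENNReal.inv_mul_cancel (by simp) (fin _)

/-- The enumeration of the dense set of probability measures which are concentrated on finitely
many points of `D` and assign rational values to them. -/
def idealMeasure (S : ComputableMetricSpace X) (c : MeasureCode) : ProbabilityMeasure X :=
  ⟨S.idealMeasureAux c, ⟨S.idealMeasureAux_univ c⟩⟩

/-- The ideal balls of the space of probability measures over `X` with the Prokhorov distance. -/
def idealMeasureBall (S : ComputableMetricSpace X) (b : MeasureCode × (ℕ × ℕ)) :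
    Set (ProbabilityMeasure X) :=
  {μ | levyProkhorovDist (μ : Measure X) (S.idealMeasure b.1 : Measure X) < codedRat b.2}

/-- The numbered basis of the product of `X` with the space of probability measures over `X`. -/
def prodBasis (S : ComputableMetricSpace X)
    (b : (ℕ × (ℕ × ℕ)) × (MeasureCode × (ℕ × ℕ))) : Set (X × ProbabilityMeasure X) :=
  S.idealBall b.1 ×ˢ S.idealMeasureBall b.2

/-- `f` is lower semicomputable relative to `μ`: it is the section at `μ` of a lower
semicomputable function of a point and a measure. -/
def LowerSemicomputableFrom (S : ComputableMetricSpace X) (μ : ProbabilityMeasure X)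
    (f : X → ℝ≥0∞) : Prop :=
  ∃ F : X × ProbabilityMeasure X → ℝ≥0∞,
    LowerSemicomputable S.prodBasis F ∧ ∀ x, f x = F (x, μ)

/-- `μ`-tests of randomness. -/
def IsTest (S : ComputableMetricSpace X) (μ : ProbabilityMeasure X) (f : X → ℝ≥0∞) : Prop :=
  S.LowerSemicomputableFrom μ f ∧ ∫⁻ x, f x ∂(μ : Measure X) ≤ 1

/-- Uniform tests of randomness; `t (x, μ)` is usually written `t_μ(x)`. -/
def IsUniformTest (S : ComputableMetricSpace X) (t : X × ProbabilityMeasure X → ℝ≥0∞) : Prop :=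
  LowerSemicomputable S.prodBasis t ∧ ∀ μ, S.IsTest μ fun x => t (x, μ)

/-- Universal uniform tests: they dominate every uniform test up to a constant factor. -/
def IsUniversalUniformTest (S : ComputableMetricSpace X)
    (u : X × ProbabilityMeasure X → ℝ≥0∞) : Prop :=
  S.IsUniformTest u ∧
    ∀ t, S.IsUniformTest t → ∃ c : ℝ≥0, 0 < c ∧ ∀ x μ, t (x, μ) ≤ c * u (x, μ)

end ComputableMetricSpace

/-- `M` is neutral with respect to the test `t` if `t_M(x) ≤ 1` for all `x`. -/
def IsNeutral {X : Type*} [MeasurableSpace X] (t : X × ProbabilityMeasure X → ℝ≥0∞)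
    (M : ProbabilityMeasure X) : Prop :=
  ∀ x, t (x, M) ≤ 1

end UniformRandomness

end

/-!
For each point `x`, let `F x` be the set of the probability measures `μ` with `t (x, μ) ≤ 1`. A
neutral measure is a common point of all the sets `F x`. These sets are closed, because `t` is
lower semicontinuous for the topology of weak convergence
(`UniformRandomness.LowerSemicomputable.isOpen_one_lt`), and the space of probability measures over
a compact space is compact. So it suffices that any finitely many of the sets, say those for the
points `x i`, have a common point, and this is found among the mixtures of the point masses at the
`x i`. These mixtures are parametrized by a standard simplex. If the mixture `μ` charges only the
`x i` with `i` in a set `J`, then `t (x i, μ) ≤ 1` for some `i ∈ J`, since the mean of `t (·, μ)`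
with respect to `μ` is at most `1`
(`exists_pos_le_one_of_lintegral_diracMixture_le`). This is the hypothesis of the
Knaster–Kuratowski–Mazurkiewicz theorem (`exists_forall_mem_of_kkm`), which yields a common point.

The Knaster–Kuratowski–Mazurkiewicz theorem is derived from Scarf's combinatorial lemma
(`exists_isDominant_image_eq_univ`), an analogue of Sperner's lemma for a finite set with several
linear orders, which involves no triangulation. It is proved by the usual parity argument: dominant
sets with as many points as there are orders ("rooms") meet along dominant sets with one point less
("doors"), a door leads to two rooms except for a single door on the boundary, and a room that does
not carry all colours has an even number of doors of a given type. Applied to the grid points of the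
simplex with the orders by the coordinates, the lemma shows in the limit that closed sets `G i`
covering the simplex have a point `x` such that `x ∈ G i` for all `i` with `x i ≠ 0`
(`exists_mem_of_ne_zero_of_cover`). The Knaster–Kuratowski–Mazurkiewicz theorem for closed sets
`F i` follows by taking for `G i` the set where `x i * ∑ j, g j x ≤ g i x`, with `g i` the distance
from `F i`.
-/

/-! ### Scarf's combinatorial lemma -/

/-- A finite set `S` is dominant for the orders given by the functions `r i` if no point `y` lies,
in every one of these orders, strictly above the minimum of `S`. -/
def IsDominant {E I α : Type*} [LinearOrder α] (r : I → E → α) (S : Finset E) : Prop :=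
  ∀ y, ∃ i, ∀ s ∈ S, r i y ≤ r i s

section Scarf

variable {E I α : Type*} [LinearOrder α] {r : I → E → α}

theorem IsDominant.subset {S R : Finset E} (hR : IsDominant r R) (h : S ⊆ R) :
    IsDominant r S := fun y => (hR y).imp fun _ hi s hs => hi s (h hs)

/-- `y` lies strictly above `m l` in all orders but the `k`-th, and is the largest such point in
the `k`-th order. -/
def IsTopAbove (r : I → E → α) (m : I → E) (k : I) (y : E) : Prop :=
  (∀ l, l ≠ k → r l (m l) < r l y) ∧
    ∀ z, (∀ l, l ≠ k → r l (m l) < r l z) → r k z ≤ r k y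

theorem IsTopAbove.unique (hr : ∀ i, Function.Injective (r i)) {m : I → E} {k : I} {y z : E}
    (hy : IsTopAbove r m k y) (hz : IsTopAbove r m k z) : y = z :=
  hr k (le_antisymm (hz.2 y hy.1) (hy.2 z hz.1))

theorem exists_isTopAbove [Finite E] {m : I → E} {k : I} {z : E}
    (hz : ∀ l, l ≠ k → r l (m l) < r l z) : ∃ y, IsTopAbove r m k y := by
  obtain ⟨y, hy, hmax⟩ := Set.exists_max_image {z | ∀ l, l ≠ k → r l (m l) < r l z} (r k)
    (Set.toFinite _) ⟨z, hz⟩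
  exact ⟨y, hy, hmax⟩

/-- The replacement step. In a dominant set `S` with one point fewer than there are orders, every
point is the minimum `m l` of `S` in some order `l`, so exactly two orders `i`, `j` share their
minimum. A point can be added to `S` without losing dominance only by becoming the new minimum in
the order `i` or in the order `j`. -/
theorem IsDominant.exists_insert_iff [Fintype I] [DecidableEq E]
    (hr : ∀ i, Function.Injective (r i)) {S : Finset E} (hS : IsDominant r S)
    (hne : S.Nonempty) (hcard : S.card + 1 = Fintype.card I) :
    ∃ (m : I → E) (i j : I), i ≠ j ∧ m i = m j ∧ (∀ l, m l ∈ S) ∧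
      (∀ l, ∀ s ∈ S, r l (m l) ≤ r l s) ∧
      ∀ y, (y ∉ S ∧ IsDominant r (insert y S)) ↔ (IsTopAbove r m i y ∨ IsTopAbove r m j y) := by
  classical
  choose m hmS hmin using fun l => S.exists_min_image (r l) hne
  have hm : ∀ l s, s ∈ S → (∀ s' ∈ S, r l s ≤ r l s') → m l = s := fun l s hs h =>
    hr l (le_antisymm (hmin l s hs) (h _ (hmS l)))
  have hsurj : ∀ s ∈ S, ∃ l, m l = s := fun s hs =>
    (hS s).imp fun l hl => hm l s hs hl
  obtain ⟨i, -, j, -, hij, hmij⟩ := Finset.exists_ne_map_eq_of_card_lt_of_maps_to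
    (s := Finset.univ) (t := S) (f := m) (by rw [Finset.card_univ]; omega) (fun l _ => hmS l)
  refine ⟨m, i, j, hij, hmij, hmS, hmin, fun y => ⟨?_, ?_⟩⟩
  · rintro ⟨hyS, hy⟩
    obtain ⟨k, hk⟩ := hy y
    -- the points of `S` are the minima of `insert y S` in orders other than `k`
    have hold : ∀ s ∈ S, ∃ l, l ≠ k ∧ m l = s ∧ r l s ≤ r l y := by
      intro s hs
      obtain ⟨l, hl⟩ := hy s
      refine ⟨l, ?_, hm l s hs fun s' hs' => hl s' (Finset.mem_insert_of_mem hs'),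
        hl y (Finset.mem_insert_self _ _)⟩
      rintro rfl
      have := hr l (le_antisymm (hl y (Finset.mem_insert_self _ _))
        (hk s (Finset.mem_insert_of_mem hs)))
      exact hyS (this ▸ hs)
    have himage : (Finset.univ.erase k).image m = S := by
      ext s
      simp only [Finset.mem_image, Finset.mem_erase, Finset.mem_univ, and_true]
      constructor
      · rintro ⟨l, -, rfl⟩
        exact hmS l
      · intro hs
        obtain ⟨l, hl, hls, -⟩ := hold s hs
        exact ⟨l, hl, hls⟩
    have hinj : Set.InjOn m (Finset.univ.erase k : Finset I) := by
      apply Finset.card_image_iff.1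
      rw [himage, Finset.card_erase_of_mem (Finset.mem_univ k), Finset.card_univ]
      omega
    have htop : IsTopAbove r m k y := by
      have habove : ∀ l, l ≠ k → r l (m l) < r l y := by
        intro l hl
        obtain ⟨l', hl', hmm, hle⟩ := hold (m l) (hmS l)
        obtain rfl : l' = l := hinj (by simp [hl']) (by simp [hl]) hmm
        refine lt_of_le_of_ne hle fun h => hyS ?_
        rw [← hr l' h]
        exact hmS l'
      refine ⟨habove, fun z hz => ?_⟩
      obtain ⟨l, hl⟩ := hy z
      by_cases hlk : l = k
      · subst hlk
        exact hl y (Finset.mem_insert_self _ _)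
      · exact absurd (hl _ (Finset.mem_insert_of_mem (hmS l))) (not_le.2 (hz l hlk))
    have hkij : k = i ∨ k = j := by
      by_contra! h
      exact hij (hinj (by simp [h.1.symm]) (by simp [h.2.symm]) hmij)
    rcases hkij with rfl | rfl
    · exact Or.inl htop
    · exact Or.inr htop
  · intro h
    obtain ⟨k, k', hkk', hmk, htop⟩ : ∃ k k', k ≠ k' ∧ m k = m k' ∧ IsTopAbove r m k y := by
      rcases h with h | h
      · exact ⟨i, j, hij, hmij, h⟩
      · exact ⟨j, i, hij.symm, hmij.symm, h⟩
    constructor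
    · intro hyS
      obtain ⟨l, rfl⟩ := hsurj y hyS
      by_cases hlk : l = k
      · subst hlk
        have := htop.1 k' hkk'.symm
        rw [hmk] at this
        exact lt_irrefl _ this
      · exact lt_irrefl _ (htop.1 l hlk)
    · intro z
      by_cases hz : ∀ l, l ≠ k → r l (m l) < r l z
      · obtain ⟨l, hl⟩ := hS z
        obtain rfl : l = k := by
          by_contra hlk
          exact absurd (hl _ (hmS l)) (not_le.2 (hz l hlk))
        exact ⟨l, Finset.forall_mem_insert _ _ _ |>.2 ⟨htop.2 z hz, hl⟩⟩
      · push Not at hz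
        obtain ⟨l, hlk, hl⟩ := hz
        exact ⟨l, Finset.forall_mem_insert _ _ _ |>.2 ⟨hl.trans (htop.1 l hlk).le,
          fun s hs => hl.trans (hmin l s hs)⟩⟩

/-- In a set with as many points as there are colours, and not coloured by all of them, an even
number of the sets obtained by deleting one point carry exactly the colours other than `i₀`. -/
theorem even_card_filter_image_erase [Fintype I] [DecidableEq I] [DecidableEq E] (c : E → I)
    (i₀ : I) {R : Finset E} (hR : R.card = Fintype.card I) (hc : R.image c ≠ Finset.univ) :
    Even (R.filter fun e => (R.erase e).image c = Finset.univ.erase i₀).card := by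
  rcases (R.filter fun e => (R.erase e).image c = Finset.univ.erase i₀).eq_empty_or_nonempty
    with h | ⟨e, he⟩
  · simp [h]
  rw [Finset.mem_filter] at he
  obtain ⟨heR, he⟩ := he
  have hinj : Set.InjOn c (R.erase e : Finset E) := by
    apply Finset.card_image_iff.1
    rw [he, Finset.card_erase_of_mem (Finset.mem_univ _), Finset.card_erase_of_mem heR, hR,
      Finset.card_univ]
  have hins : insert (c e) (Finset.univ.erase i₀) = R.image c := by
    rw [← he, ← Finset.image_insert, Finset.insert_erase heR]
  have hce : c e ≠ i₀ := by
    rintro rfl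
    exact hc (by rw [← hins, Finset.insert_erase (Finset.mem_univ _)])
  have hi₀ : i₀ ∉ R.image c := by
    rw [← hins]
    simp [hce.symm]
  obtain ⟨e', he', hcc⟩ : ∃ e' ∈ R.erase e, c e' = c e := by
    rw [← Finset.mem_image, he]
    simp [hce]
  obtain ⟨hee', he'R⟩ := Finset.mem_erase.1 he'
  have : (R.filter fun e => (R.erase e).image c = Finset.univ.erase i₀) = {e, e'} := by
    ext x
    simp only [Finset.mem_filter, Finset.mem_insert, Finset.mem_singleton]
    constructor
    · rintro ⟨hxR, hx⟩
      by_contra! hne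
      -- the colour of a third point of `R` is not repeated
      have : c x ∈ (R.erase x).image c := by
        rw [hx]
        exact Finset.mem_erase.2 ⟨fun h => hi₀ (h ▸ Finset.mem_image_of_mem c hxR),
          Finset.mem_univ _⟩
      obtain ⟨z, hz, hzx⟩ := Finset.mem_image.1 this
      obtain ⟨hzx', hzR⟩ := Finset.mem_erase.1 hz
      have hxe : x ∈ R.erase e := Finset.mem_erase.2 ⟨hne.1, hxR⟩
      by_cases hze : z = e
      · subst hze
        exact hne.2 (hinj hxe he' (hzx.symm.trans hcc.symm))
      · exact hzx' (hinj (Finset.mem_erase.2 ⟨hze, hzR⟩) hxe hzx)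
    · rintro (rfl | rfl)
      · exact ⟨heR, he⟩
      · refine ⟨he'R, ?_⟩
        rw [← he]
        ext k
        simp only [Finset.mem_image, Finset.mem_erase]
        constructor
        · rintro ⟨z, ⟨hz, hzR⟩, rfl⟩
          by_cases hze : z = e
          · subst hze
            exact ⟨x, ⟨hee', he'R⟩, hcc⟩
          · exact ⟨z, ⟨hze, hzR⟩, rfl⟩
        · rintro ⟨z, ⟨hz, hzR⟩, rfl⟩
          by_cases hze : z = x
          · subst hze
            exact ⟨e, ⟨hee'.symm, heR⟩, hcc.symm⟩
          · exact ⟨z, ⟨hze, hzR⟩, rfl⟩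
  rw [this, Finset.card_pair hee'.symm]
  exact even_two

/-- **Scarf's combinatorial lemma.** The points `s i` play the role of the vertices of a simplex:
`s i` is the smallest point in the order `i`, and in the other orders it lies above all points
which are not of this form. Then some dominant set carries every colour exactly once. -/
theorem exists_isDominant_image_eq_univ [Fintype E] [Fintype I] [DecidableEq I] [Nontrivial I]
    (hr : ∀ i, Function.Injective (r i)) (s : I → E) (c : E → I) (hc : ∀ i, c (s i) = i)
    (hbot : ∀ i e, r i (s i) ≤ r i e)
    (htop : ∀ i j e, i ≠ j → e ∉ Set.range s → r i e < r i (s j)) :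
    ∃ R : Finset E, IsDominant r R ∧ R.card = Fintype.card I ∧ R.image c = Finset.univ := by
  classical
  by_contra! hno
  obtain ⟨i₀⟩ : Nonempty I := inferInstance
  have hs : Function.Injective s := Function.LeftInverse.injective hc
  -- a room is a dominant set with as many points as there are orders; a door is a dominant set with
  -- one point less which carries exactly the colours other than `i₀`
  let rooms : Finset (Finset E) :=
    Finset.univ.filter fun R => IsDominant r R ∧ R.card = Fintype.card I
  let doors : Finset (Finset E) :=
    Finset.univ.filter fun S => IsDominant r S ∧ S.card + 1 = Fintype.card I ∧
      S.image c = Finset.univ.erase i₀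
  have hdouble := Finset.sum_card_bipartiteAbove_eq_sum_card_bipartiteBelow
    (fun S R : Finset E => S ⊆ R) (s := doors) (t := rooms)
  have hrooms : ∀ R ∈ rooms, Even (doors.bipartiteBelow (fun S R : Finset E => S ⊆ R) R).card := by
    intro R hR
    obtain ⟨hRd, hRc⟩ : IsDominant r R ∧ R.card = Fintype.card I := by simpa [rooms] using hR
    convert even_card_filter_image_erase c i₀ hRc (hno R hRd hRc) using 1
    rw [← Finset.card_image_of_injOn (f := R.erase)
      (fun x hx y _ hxy => (Finset.erase_inj R (Finset.mem_filter.1 hx).1).1 hxy)]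
    congr 1
    ext S
    simp only [Finset.mem_bipartiteBelow, doors, Finset.mem_filter, Finset.mem_univ, true_and,
      Finset.mem_image]
    constructor
    · rintro ⟨⟨-, hScard, hSc⟩, hSR⟩
      obtain ⟨e, heS, rfl⟩ : ∃ e, e ∉ S ∧ insert e S = R :=
        Finset.exists_eq_insert_iff.2 ⟨hSR, by omega⟩
      exact ⟨e, ⟨Finset.mem_insert_self _ _, by rwa [Finset.erase_insert heS]⟩,
        Finset.erase_insert heS⟩
    · rintro ⟨e, ⟨heR, he⟩, rfl⟩
      refine ⟨⟨hRd.subset (Finset.erase_subset _ _), ?_, he⟩, Finset.erase_subset _ _⟩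
      rw [Finset.card_erase_add_one heR, hRc]
  -- the rooms behind a door, as insertions of a point
  have habove : ∀ S ∈ doors,
      rooms.bipartiteAbove (fun S R : Finset E => S ⊆ R) S =
        (Finset.univ.filter fun y => y ∉ S ∧ IsDominant r (insert y S)).image (insert · S) := by
    intro S hS
    obtain ⟨-, hScard, -⟩ : IsDominant r S ∧ S.card + 1 = Fintype.card I ∧
      S.image c = Finset.univ.erase i₀ := by simpa [doors] using hS
    ext R
    simp only [Finset.mem_bipartiteAbove, rooms, Finset.mem_filter, Finset.mem_univ, true_and,
      Finset.mem_image]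
    constructor
    · rintro ⟨⟨hRd, hRc⟩, hSR⟩
      obtain ⟨e, heS, rfl⟩ : ∃ e, e ∉ S ∧ insert e S = R :=
        Finset.exists_eq_insert_iff.2 ⟨hSR, by omega⟩
      exact ⟨e, ⟨heS, hRd⟩, rfl⟩
    · rintro ⟨y, ⟨hyS, hy⟩, rfl⟩
      exact ⟨⟨hy, by rw [Finset.card_insert_of_notMem hyS, hScard]⟩, Finset.subset_insert _ _⟩
  have hcardabove : ∀ S ∈ doors,
      (rooms.bipartiteAbove (fun S R : Finset E => S ⊆ R) S).card =
        (Finset.univ.filter fun y => y ∉ S ∧ IsDominant r (insert y S)).card := by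
    intro S hS
    rw [habove S hS]
    refine Finset.card_image_of_injOn fun x hx y _ hxy => ?_
    exact (Finset.insert_inj (Finset.mem_filter.1 hx).2.1).1 hxy
  have hdoorne : ∀ S ∈ doors, S.Nonempty := by
    intro S hS
    obtain ⟨-, hScard, -⟩ : IsDominant r S ∧ S.card + 1 = Fintype.card I ∧
      S.image c = Finset.univ.erase i₀ := by simpa [doors] using hS
    have := Fintype.one_lt_card (α := I)
    exact Finset.card_pos.1 (by omega)
  -- the only door on the boundary
  let S₀ : Finset E := (Finset.univ.erase i₀).image s
  have hS₀c : S₀.card + 1 = Fintype.card I := by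
    rw [Finset.card_image_of_injective _ hs, Finset.card_erase_add_one (Finset.mem_univ _),
      Finset.card_univ]
  obtain ⟨j₀, hj₀⟩ := exists_ne i₀
  have hmemS₀ : ∀ e, e ∈ S₀ ↔ ∃ l, l ≠ i₀ ∧ s l = e := by simp [S₀]
  have hS₀ : S₀ ∈ doors := by
    simp only [doors, Finset.mem_filter, Finset.mem_univ, true_and]
    refine ⟨fun y => ?_, hS₀c, ?_⟩
    · by_cases hy : y ∈ Set.range s
      · obtain ⟨l, rfl⟩ := hy
        exact ⟨l, fun e _ => hbot l e⟩
      · refine ⟨i₀, fun e he => ?_⟩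
        obtain ⟨l, hl, rfl⟩ := (hmemS₀ e).1 he
        exact (htop i₀ l y hl.symm hy).le
    · rw [Finset.image_image]
      ext k
      simp [hc]
  have hone : (rooms.bipartiteAbove (fun S R : Finset E => S ⊆ R) S₀).card = 1 := by
    rw [hcardabove S₀ hS₀]
    obtain ⟨m, i, j, hij, hmij, hmS, hmin, hiff⟩ :=
      IsDominant.exists_insert_iff hr (Finset.mem_filter.1 hS₀).2.1 (hdoorne S₀ hS₀) hS₀c
    simp only [hiff]
    have hms : ∀ l, l ≠ i₀ → m l = s l := fun l hl =>
      hr l (le_antisymm (hmin l _ ((hmemS₀ _).2 ⟨l, hl, rfl⟩)) (hbot l _))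
    -- the order `i₀` shares its minimum with some other order `k`
    obtain ⟨k, hk, hmk, hor⟩ : ∃ k, k ≠ i₀ ∧ m i₀ = m k ∧
        ∀ y, (IsTopAbove r m i y ∨ IsTopAbove r m j y) ↔
          (IsTopAbove r m i₀ y ∨ IsTopAbove r m k y) := by
      by_cases hi : i = i₀
      · subst hi
        exact ⟨j, hij.symm, hmij, fun y => Iff.rfl⟩
      · by_cases hj : j = i₀
        · subst hj
          exact ⟨i, hij, hmij.symm, fun y => or_comm⟩
        · rw [hms i hi, hms j hj] at hmij
          exact absurd (hs hmij) hij
    have hempty : ∀ y, ¬ IsTopAbove r m k y := by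
      intro y hy
      have h0 := hy.1 i₀ hk.symm
      rw [hmk, hms k hk] at h0
      by_cases hyr : y ∈ Set.range s
      · obtain ⟨l, rfl⟩ := hyr
        by_cases hl : l = i₀
        · subst hl
          exact absurd h0 (not_lt.2 (hbot l _))
        · by_cases hlk : l = k
          · subst hlk
            exact lt_irrefl _ h0
          · have := hy.1 l hlk
            rw [hms l hl] at this
            exact lt_irrefl _ this
      · exact lt_asymm h0 (htop i₀ k y hk.symm hyr)
    obtain ⟨y₀, hy₀⟩ : ∃ y, IsTopAbove r m i₀ y := by
      refine exists_isTopAbove (z := s i₀) fun l hl => ?_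
      rw [hms l hl]
      exact lt_of_le_of_ne (hbot l _) fun h => hl (hs (hr l h))
    rw [Finset.card_eq_one]
    refine ⟨y₀, ?_⟩
    ext y
    simp only [Finset.mem_filter, Finset.mem_univ, true_and, Finset.mem_singleton, hor, hempty,
      or_false]
    exact ⟨fun h => h.unique hr hy₀, fun h => h ▸ hy₀⟩
  have htwo : ∀ S ∈ doors.erase S₀,
      Even (rooms.bipartiteAbove (fun S R : Finset E => S ⊆ R) S).card := by
    intro S hS'
    obtain ⟨hSS₀, hS⟩ := Finset.mem_erase.1 hS'
    rw [hcardabove S hS]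
    obtain ⟨hSd, hScard, hSc⟩ := (Finset.mem_filter.1 hS).2
    obtain ⟨m, i, j, hij, hmij, hmS, hmin, hiff⟩ :=
      IsDominant.exists_insert_iff hr hSd (hdoorne S hS) hScard
    simp only [hiff]
    obtain ⟨e, heS, he⟩ : ∃ e ∈ S, e ∉ Set.range s := by
      by_contra! h
      refine hSS₀ (Finset.eq_of_subset_of_card_le (fun e he => ?_) (by omega))
      obtain ⟨l, rfl⟩ := h e he
      refine (hmemS₀ _).2 ⟨l, ?_, rfl⟩
      have := Finset.mem_image_of_mem c he
      rw [hSc, hc] at this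
      exact (Finset.mem_erase.1 this).1
    have hex : ∀ k, ∃ y, IsTopAbove r m k y := fun k =>
      exists_isTopAbove (z := s k) fun l hl => (hmin l e heS).trans_lt (htop l k e hl he)
    obtain ⟨y₁, hy₁⟩ := hex i
    obtain ⟨y₂, hy₂⟩ := hex j
    have hne : y₁ ≠ y₂ := by
      rintro rfl
      obtain ⟨l, hl⟩ := hSd y₁
      by_cases hli : l = i
      · subst hli
        exact absurd (hl _ (hmS l)) (not_le.2 (hy₂.1 l hij))
      · exact absurd (hl _ (hmS l)) (not_le.2 (hy₁.1 l hli))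
    have : (Finset.univ.filter fun y => IsTopAbove r m i y ∨ IsTopAbove r m j y) = {y₁, y₂} := by
      ext y
      simp only [Finset.mem_filter, Finset.mem_univ, true_and, Finset.mem_insert,
        Finset.mem_singleton]
      constructor
      · rintro (h | h)
        · exact Or.inl (h.unique hr hy₁)
        · exact Or.inr (h.unique hr hy₂)
      · rintro (rfl | rfl)
        · exact Or.inl hy₁
        · exact Or.inr hy₂
    rw [this, Finset.card_pair hne]
    exact even_two
  have heven : Even (∑ R ∈ rooms, (doors.bipartiteBelow (fun S R : Finset E => S ⊆ R) R).card) :=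
    Finset.even_sum _ hrooms
  rw [← hdouble, ← Finset.sum_erase_add _ _ hS₀, hone] at heven
  exact Nat.not_even_iff_odd.2 ((Finset.even_sum _ htwo).add_one) heven

end Scarf

/-! ### The Knaster–Kuratowski–Mazurkiewicz theorem -/

section KKM

variable {I : Type*} [Fintype I]

/-- The discrete form of `exists_mem_of_ne_zero_of_cover`, for the points of the standard simplex
whose coordinates are multiples of `1 / N`, here multiplied by `N`. The relation `P y i` says that
`y` may be given the colour `i`. Scarf's lemma is applied to the orders by the coordinates, with an
arbitrary rule for ties: if `C` is the set of `i` whose added point is not in the dominant set and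
`m i` is the least `i`-th coordinate of a grid point of that set, then the `m i` with `i ∈ C` add
up to nearly `N`, so that all grid points of the set are close to each other. -/
theorem exists_grid_point_near_colors [Nontrivial I] (N : ℕ) (P : (I → ℕ) → I → Prop)
    (hP : ∀ y, ∑ i, y i = N → ∃ i, P y i) :
    ∃ (C : Finset I) (x : I → ℕ), ∑ i, x i = N ∧ (∀ k ∉ C, x k ≤ Fintype.card I) ∧
      ∀ i ∈ C, ∃ y, ∑ i, y i = N ∧ P y i ∧
        ∀ k, x k ≤ y k + Fintype.card I ∧ y k ≤ x k + Fintype.card I := by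
  classical
  let T := {y : I → ℕ // y ∈ Finset.piAntidiag Finset.univ N}
  let _ : Fintype T := inferInstanceAs (Fintype (Finset.piAntidiag (Finset.univ : Finset I) N))
  have hT : ∀ y : T, ∑ i, y.1 i = N := fun y => (Finset.mem_piAntidiag.1 y.2).1
  let mk : ∀ y : I → ℕ, ∑ i, y i = N → T := fun y hy =>
    ⟨y, Finset.mem_piAntidiag.2 ⟨hy, fun i _ => Finset.mem_univ i⟩⟩
  choose col hcol using fun y : T => hP y.1 (hT y)
  -- the added points have `i`-th coordinate `-1` and all other coordinates `N + 1`
  let v : I → T ⊕ I → ℤ := fun i e =>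
    Sum.elim (fun y : T => (y.1 i : ℤ)) (fun j => if j = i then -1 else N + 1) e
  let r : I → T ⊕ I → ℤ ×ₗ Fin (Fintype.card (T ⊕ I)) := fun i e =>
    toLex (v i e, Fintype.equivFin (T ⊕ I) e)
  have hr : ∀ i, Function.Injective (r i) := fun i e e' h =>
    (Fintype.equivFin (T ⊕ I)).injective (congrArg (fun p => (ofLex p).2) h)
  have hlt : ∀ i e e', v i e < v i e' → r i e < r i e' := fun i e e' h =>
    Prod.Lex.toLex_lt_toLex.2 (Or.inl h)
  have hle : ∀ i e e', r i e ≤ r i e' → v i e ≤ v i e' := fun i e e' h =>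
    not_lt.1 fun h' => absurd h (not_le.2 (hlt i e' e h'))
  have hyN : ∀ (y : T) i, y.1 i ≤ N := fun y i =>
    (Finset.single_le_sum (f := y.1) (fun _ _ => Nat.zero_le _) (Finset.mem_univ i)).trans
      (hT y).le
  obtain ⟨R, hRd, hRcard, hRcol⟩ := exists_isDominant_image_eq_univ hr Sum.inr (Sum.elim col id)
    (fun i => rfl)
    (by
      rintro i (y | j)
      · apply le_of_lt
        apply hlt
        simp only [v, Sum.elim_inl, Sum.elim_inr, if_true]
        omega
      · by_cases hj : j = i
        · rw [hj]
        · apply le_of_lt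
          apply hlt
          simp only [v, Sum.elim_inr, if_true, if_neg hj]
          omega)
    (by
      rintro i j (y | k) hij he
      · apply hlt
        simp only [v, Sum.elim_inl, Sum.elim_inr, if_neg hij.symm]
        have := hyN y i
        omega
      · exact absurd ⟨k, rfl⟩ he)
  let C : Finset I := Finset.univ.filter fun i => Sum.inr i ∉ R
  have hC : ∀ i, i ∈ C ↔ Sum.inr i ∉ R := by simp [C]
  have hcolC : ∀ i ∈ C, ∃ y : T, Sum.inl y ∈ R ∧ col y = i := by
    intro i hi
    have : i ∈ R.image (Sum.elim col id) := hRcol ▸ Finset.mem_univ i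
    obtain ⟨y | j, he, hei⟩ := Finset.mem_image.1 this
    · exact ⟨y, he, hei⟩
    · obtain rfl : j = i := hei
      exact absurd he ((hC j).1 hi)
  -- no grid point exceeds all points of `R` in all the coordinates in `C`
  have hdom : ∀ z : T, ∃ i ∈ C, ∀ y : T, Sum.inl y ∈ R → z.1 i ≤ y.1 i := by
    intro z
    obtain ⟨i, hi⟩ := hRd (Sum.inl z)
    refine ⟨i, (hC i).2 fun h => ?_, fun y hy => ?_⟩
    · have := hle _ _ _ (hi _ h)
      simp only [v, Sum.elim_inl, Sum.elim_inr, if_true] at this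
      omega
    · have := hle _ _ _ (hi _ hy)
      simpa [v] using this
  obtain ⟨i₀⟩ : Nonempty I := inferInstance
  let σ : Finset T := Finset.univ.filter fun y => Sum.inl y ∈ R
  have hσ : ∀ y, y ∈ σ ↔ Sum.inl y ∈ R := by simp [σ]
  have hσne : σ.Nonempty := by
    obtain ⟨i, hi, -⟩ := hdom (mk (Pi.single i₀ N) (by simp))
    obtain ⟨y, hy, -⟩ := hcolC i hi
    exact ⟨y, (hσ y).2 hy⟩
  choose w hwσ hw using fun i => σ.exists_min_image (fun y => y.1 i) hσne
  let m : I → ℕ := fun i => (w i).1 i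
  have hm : ∀ y ∈ σ, ∀ i, m i ≤ y.1 i := fun y hy i => hw i y hy
  have hsum : N < ∑ i ∈ C, (m i + 1) := by
    by_contra! h
    let z : I → ℕ := fun i => (if i ∈ C then m i + 1 else 0) +
      (if i = i₀ then N - ∑ i ∈ C, (m i + 1) else 0)
    have hz : ∑ i, z i = N := by
      simp only [z, Finset.sum_add_distrib, Finset.sum_ite_mem, Finset.univ_inter,
        Finset.sum_ite_eq', Finset.mem_univ, if_true] at h ⊢
      omega
    obtain ⟨i, hi, hzi⟩ := hdom (mk z hz)
    have h1 : z i ≤ m i := hzi (w i) ((hσ _).1 (hwσ i))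
    simp only [z, if_pos hi] at h1
    omega
  rw [Finset.sum_add_distrib, Finset.sum_const, smul_eq_mul, mul_one] at hsum
  have hCcard : C.card ≤ Fintype.card I := Finset.card_le_univ C
  have hout : ∀ y ∈ σ, ∀ k ∉ C, y.1 k ≤ Fintype.card I := by
    intro y hy k hk
    have h1 : ∑ i ∈ C, m i ≤ ∑ i ∈ C, y.1 i := Finset.sum_le_sum fun i _ => hm y hy i
    have h2 : ∑ i ∈ insert k C, y.1 i ≤ ∑ i, y.1 i :=
      Finset.sum_le_sum_of_subset (Finset.subset_univ _)
    rw [Finset.sum_insert hk, hT y] at h2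
    omega
  have hin : ∀ y ∈ σ, ∀ k ∈ C, y.1 k ≤ m k + Fintype.card I := by
    intro y hy k hk
    have h1 : ∑ i ∈ C.erase k, m i ≤ ∑ i ∈ C.erase k, y.1 i :=
      Finset.sum_le_sum fun i _ => hm y hy i
    have h2 : ∑ i ∈ C, y.1 i ≤ ∑ i, y.1 i := Finset.sum_le_sum_of_subset (Finset.subset_univ _)
    rw [← Finset.add_sum_erase _ _ hk, hT y] at h2
    rw [← Finset.add_sum_erase _ _ hk] at hsum
    omega
  have hnear : ∀ x ∈ σ, ∀ y ∈ σ, ∀ k, x.1 k ≤ y.1 k + Fintype.card I := by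
    intro x hx y hy k
    by_cases hk : k ∈ C
    · have := hin x hx k hk
      have := hm y hy k
      omega
    · have := hout x hx k hk
      omega
  obtain ⟨x, hx⟩ := hσne
  refine ⟨C, x.1, hT x, hout x hx, fun i hi => ?_⟩
  obtain ⟨y, hy, rfl⟩ := hcolC i hi
  rw [← hσ] at hy
  exact ⟨y.1, hT y, hcol y, fun k => ⟨hnear x hx y hy k, hnear y hy x hx k⟩⟩

/-- If closed sets `G i` cover the standard simplex, some point lies in all the sets `G i` whose
index belongs to its support. -/
theorem exists_mem_of_ne_zero_of_cover [Nontrivial I] (G : I → Set (stdSimplex ℝ I))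
    (hG : ∀ i, IsClosed (G i)) (hcov : ∀ x, ∃ i, x ∈ G i) :
    ∃ x : stdSimplex ℝ I, ∀ i, x.1 i ≠ 0 → x ∈ G i := by
  let n := Fintype.card I
  let pt : ∀ (N : ℕ) (y : I → ℕ), ∑ i, y i = N + 1 → stdSimplex ℝ I := fun N y hy =>
    ⟨fun i => (y i : ℝ) / (N + 1), fun i => by positivity, by
      rw [← Finset.sum_div, ← Nat.cast_sum, hy]
      push_cast
      exact div_self (by positivity)⟩
  choose C x hx hout hC using fun N : ℕ => exists_grid_point_near_colors (N + 1)
    (fun y i => ∃ hy : ∑ i, y i = N + 1, pt N y hy ∈ G i) (fun y hy => by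
      obtain ⟨i, hi⟩ := hcov (pt N y hy)
      exact ⟨i, hy, hi⟩)
  -- a limit along an ultrafilter, which also makes membership in the finite sets `C N` constant
  let U : Ultrafilter ℕ := Filter.hyperfilter ℕ
  have hU : (U : Filter ℕ) ≤ Filter.atTop := by
    rw [← Nat.cofinite_eq_atTop]
    exact Filter.hyperfilter_le_cofinite
  let p : ℕ → stdSimplex ℝ I := fun N => pt N (x N) (hx N)
  obtain ⟨a, -, ha⟩ := isCompact_univ.ultrafilter_le_nhds (U.map p) (by simp)
  have hlim : Filter.Tendsto p U (nhds a) := ha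
  have hcoord : ∀ i, Filter.Tendsto (fun N => (p N).1 i) U (nhds (a.1 i)) := fun i =>
    (((continuous_apply i).comp continuous_subtype_val).tendsto a).comp hlim
  have hsmall : Filter.Tendsto (fun N : ℕ => (n : ℝ) / ((N : ℝ) + 1)) U (nhds 0) :=
    (tendsto_const_div_atTop_nhds_zero_nat (n : ℝ) |>.comp (Filter.tendsto_add_atTop_nat 1)
      |>.congr fun N => by simp).mono_left hU
  refine ⟨a, fun i hi => ?_⟩
  have hev : ∀ᶠ N in U, i ∈ C N := by
    by_contra h
    rw [← Ultrafilter.eventually_not] at h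
    refine hi (le_antisymm (le_of_tendsto_of_tendsto (hcoord i) hsmall ?_) (a.2.1 i))
    filter_upwards [h] with N hN
    exact div_le_div_of_nonneg_right (by exact_mod_cast hout N i hN) (by positivity)
  classical
  let q : ℕ → stdSimplex ℝ I := fun N => if h : i ∈ C N then
    pt N (hC N i h).choose (hC N i h).choose_spec.1 else p N
  have hq : ∀ N, i ∈ C N → q N ∈ G i ∧ ∀ k, |(q N).1 k - (p N).1 k| ≤ n / ((N : ℝ) + 1) := by
    intro N h
    simp only [q, dif_pos h]
    obtain ⟨h1, ⟨-, h2⟩, h3⟩ := (hC N i h).choose_spec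
    refine ⟨h2, fun k => ?_⟩
    simp only [p, pt]
    rw [← sub_div, abs_div, abs_of_pos (a := (N : ℝ) + 1) (by positivity)]
    refine div_le_div_of_nonneg_right ?_ (by positivity)
    obtain ⟨h4, h5⟩ := h3 k
    rw [abs_le]
    constructor
    · have : (x N k : ℝ) ≤ (hC N i h).choose k + n := by exact_mod_cast h4
      linarith
    · have : ((hC N i h).choose k : ℝ) ≤ x N k + n := by exact_mod_cast h5
      linarith
  have hqlim : Filter.Tendsto q U (nhds a) := by
    rw [tendsto_subtype_rng, tendsto_pi_nhds]
    intro k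
    have hd : Filter.Tendsto (fun N => (q N).1 k - (p N).1 k) U (nhds 0) := by
      refine squeeze_zero_norm' ?_ hsmall
      filter_upwards [hev] with N hN
      exact (hq N hN).2 k
    simpa using hd.add (hcoord k)
  refine (hG i).mem_of_tendsto hqlim ?_
  filter_upwards [hev] with N hN
  exact (hq N hN).1

/-- **Knaster–Kuratowski–Mazurkiewicz theorem.** Closed subsets `F i` of the standard simplex have
a common point if every face of the simplex is covered by the sets `F i` with `i` a vertex of that
face. -/
theorem exists_forall_mem_of_kkm [Nonempty I] (F : I → Set (stdSimplex ℝ I))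
    (hF : ∀ i, IsClosed (F i)) (hcov : ∀ x : stdSimplex ℝ I, ∃ i, 0 < x.1 i ∧ x ∈ F i) :
    ∃ x, ∀ i, x ∈ F i := by
  classical
  -- a vertex is a face by itself
  have hvertex : ∀ i, (⟨Pi.single i 1, single_mem_stdSimplex ℝ i⟩ : stdSimplex ℝ I) ∈ F i := by
    intro i
    obtain ⟨j, hj, hjF⟩ := hcov ⟨Pi.single i 1, single_mem_stdSimplex ℝ i⟩
    obtain rfl : j = i := by
      by_contra h
      simp [h] at hj
    exact hjF
  rcases subsingleton_or_nontrivial I with hI | hI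
  · obtain ⟨i₀⟩ := ‹Nonempty I›
    obtain ⟨v, hv⟩ : ∃ v, v ∈ F i₀ := ⟨_, hvertex i₀⟩
    exact ⟨v, fun i => Subsingleton.elim i₀ i ▸ hv⟩
  let g : I → stdSimplex ℝ I → ℝ := fun i x => Metric.infDist x (F i)
  have hg : ∀ i, Continuous (g i) := fun i => Metric.continuous_infDist_pt _
  have hg0 : ∀ i x, 0 ≤ g i x := fun i x => Metric.infDist_nonneg
  have hxg : ∀ x : stdSimplex ℝ I, ∑ i, x.1 i * ∑ j, g j x = ∑ i, g i x := fun x => by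
    rw [← Finset.sum_mul, x.2.2, one_mul]
  -- at the point found here, the coordinates are proportional to the distances `g i` from `F i`,
  -- and one of the positive coordinates has distance zero
  obtain ⟨x, hx⟩ := exists_mem_of_ne_zero_of_cover
    (fun i => {x : stdSimplex ℝ I | x.1 i * ∑ j, g j x ≤ g i x})
    (fun i => isClosed_le (((continuous_apply i).comp continuous_subtype_val).mul
      (continuous_finsetSum _ fun j _ => hg j)) (hg i))
    (fun x => by
      obtain ⟨i, -, hi⟩ := Finset.exists_le_of_sum_le Finset.univ_nonempty (hxg x).le
      exact ⟨i, hi⟩)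
  have hle : ∀ i, x.1 i * ∑ j, g j x ≤ g i x := by
    intro i
    by_cases h : x.1 i = 0
    · rw [h, zero_mul]
      exact hg0 i x
    · exact hx i h
  -- the sums over `i` of both sides agree, so that these inequalities are equalities
  have heq : ∀ i, x.1 i * ∑ j, g j x = g i x := fun i =>
    (Finset.sum_eq_sum_iff_of_le fun i _ => hle i).1 (hxg x) i (Finset.mem_univ i)
  obtain ⟨k, hk, hkF⟩ := hcov x
  have hsum : ∑ j, g j x = 0 := by
    have : g k x = 0 := Metric.infDist_zero_of_mem hkF
    rw [← heq k] at this
    exact (mul_eq_zero.1 this).resolve_left hk.ne'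
  refine ⟨x, fun i => ((hF i).mem_iff_infDist_zero ⟨_, hvertex i⟩).2 ?_⟩
  exact (Finset.sum_eq_zero_iff_of_nonneg fun i _ => hg0 i x).1 hsum i (Finset.mem_univ i)

end KKM

/-! ### Mixtures of point masses -/

section Mixtures

variable {X ι : Type*} [MeasurableSpace X] [Fintype ι]

/-- The mixture of the point masses at the points `x i` with the weights `w i`. -/
noncomputable def diracMixture (x : ι → X) (w : stdSimplex ℝ ι) : ProbabilityMeasure X :=
  ⟨∑ i, ENNReal.ofReal (w.1 i) • Measure.dirac (x i), ⟨by
    simp only [Measure.coe_finsetSum, Finset.sum_apply, Measure.smul_apply, measure_univ,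
      smul_eq_mul, mul_one]
    rw [← ENNReal.ofReal_sum_of_nonneg fun i _ => w.2.1 i, w.2.2, ENNReal.ofReal_one]⟩⟩

theorem lintegral_diracMixture [MeasurableSingletonClass X] (x : ι → X) (w : stdSimplex ℝ ι)
    (f : X → ℝ≥0∞) :
    ∫⁻ y, f y ∂(diracMixture x w : Measure X) = ∑ i, ENNReal.ofReal (w.1 i) * f (x i) := by
  simp [diracMixture]

theorem continuous_diracMixture [TopologicalSpace X] [OpensMeasurableSpace X]
    [MeasurableSingletonClass X] (x : ι → X) : Continuous (diracMixture x) := by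
  rw [ProbabilityMeasure.continuous_iff_forall_continuous_lintegral]
  intro f
  simp only [lintegral_diracMixture]
  exact continuous_finsetSum _ fun i _ => (ENNReal.continuous_mul_const ENNReal.coe_ne_top).comp
    (ENNReal.continuous_ofReal.comp ((continuous_apply i).comp continuous_subtype_val))

/-- A function of mean at most `1` with respect to a mixture of point masses is at most `1` at one
of the points carrying the mixture. -/
theorem exists_pos_le_one_of_lintegral_diracMixture_le [MeasurableSingletonClass X] {x : ι → X}
    {w : stdSimplex ℝ ι} {f : X → ℝ≥0∞}
    (hf : ∫⁻ y, f y ∂(diracMixture x w : Measure X) ≤ 1) : ∃ i, 0 < w.1 i ∧ f (x i) ≤ 1 := by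
  classical
  by_contra! h
  let J : Finset ι := Finset.univ.filter fun i => 0 < w.1 i
  have hJ : ∑ i ∈ J, ENNReal.ofReal (w.1 i) = 1 := by
    rw [← ENNReal.ofReal_sum_of_nonneg fun i _ => w.2.1 i, ← ENNReal.ofReal_one, ← w.2.2]
    congr 1
    refine Finset.sum_subset (Finset.subset_univ _) fun i _ hi => ?_
    exact le_antisymm (by simpa [J] using hi) (w.2.1 i)
  have hne : J.Nonempty := by
    rw [Finset.nonempty_iff_ne_empty]
    intro h0
    simp [h0] at hJ
  have hlt : ∑ i ∈ J, ENNReal.ofReal (w.1 i) < ∑ i ∈ J, ENNReal.ofReal (w.1 i) * f (x i) := by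
    refine ENNReal.sum_lt_sum_of_nonempty hne fun i hi => ?_
    have hi : 0 < w.1 i := (Finset.mem_filter.1 hi).2
    simpa using ENNReal.mul_lt_mul_right (ENNReal.ofReal_pos.2 hi).ne' ENNReal.ofReal_ne_top
      (h i hi)
  rw [hJ] at hlt
  refine absurd (hlt.trans_le ?_) (not_lt.2 hf)
  rw [lintegral_diracMixture]
  exact Finset.sum_le_sum_of_subset (Finset.subset_univ _)

end Mixtures

/-! ### Neutral measures -/

/-- The topological content of the existence of neutral measures. Computability of the test `t`
enters only through the closedness of the sets of measures `μ` with `t (x, μ) ≤ 1`. -/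
theorem exists_probabilityMeasure_forall_le_one {X : Type*} [MetricSpace X] [CompactSpace X]
    [Nonempty X] [MeasurableSpace X] [BorelSpace X] (t : X × ProbabilityMeasure X → ℝ≥0∞)
    (hclosed : ∀ x, IsClosed {μ : ProbabilityMeasure X | t (x, μ) ≤ 1})
    (hint : ∀ μ : ProbabilityMeasure X, ∫⁻ x, t (x, μ) ∂(μ : Measure X) ≤ 1) :
    ∃ M : ProbabilityMeasure X, ∀ x, t (x, M) ≤ 1 := by
  suffices h : (⋂ x, {μ : ProbabilityMeasure X | t (x, μ) ≤ 1}).Nonempty by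
    obtain ⟨M, hM⟩ := h
    exact ⟨M, fun x => Set.mem_iInter.1 hM x⟩
  refine CompactSpace.iInter_nonempty hclosed fun J => ?_
  rcases J.eq_empty_or_nonempty with rfl | ⟨x₀, hx₀⟩
  · obtain ⟨x⟩ := ‹Nonempty X›
    exact ⟨⟨Measure.dirac x, inferInstance⟩,
      Set.mem_iInter₂.2 fun y hy => absurd hy (Finset.notMem_empty y)⟩
  have : Nonempty J := ⟨⟨x₀, hx₀⟩⟩
  let φ : stdSimplex ℝ J → ProbabilityMeasure X := diracMixture fun x : J => (x : X)
  obtain ⟨w, hw⟩ := exists_forall_mem_of_kkm (fun x : J => φ ⁻¹' {μ | t (x, μ) ≤ 1})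
    (fun x => (hclosed x).preimage (continuous_diracMixture _))
    (fun w => exists_pos_le_one_of_lintegral_diracMixture_le (f := fun x => t (x, φ w))
      (hint (φ w)))
  exact ⟨φ w, Set.mem_iInter₂.2 fun x hx => hw ⟨x, hx⟩⟩

/-- The ideal balls of measures are open in the topology of weak convergence, since the Prokhorov
distance induces this topology on a separable space. -/
theorem UniformRandomness.ComputableMetricSpace.isOpen_prodBasis {X : Type*} [MetricSpace X]
    [MeasurableSpace X] [BorelSpace X] (S : ComputableMetricSpace X)
    (b : (ℕ × (ℕ × ℕ)) × (MeasureCode × (ℕ × ℕ))) : IsOpen (S.prodBasis b) := by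
  have : TopologicalSpace.SeparableSpace X := ⟨Set.range S.α, Set.countable_range _, S.dense⟩
  refine Metric.isOpen_ball.prod ?_
  exact (Metric.isOpen_ball (x := LevyProkhorov.ofMeasure (S.idealMeasure b.2.1))
    (ε := (codedRat b.2.2 : ℝ))).preimage
      LevyProkhorov.probabilityMeasureHomeomorph.continuous_toFun

/-- The superlevel set at `1`, the number with code `(1, 0)`, is a union of basis sets. -/
theorem UniformRandomness.LowerSemicomputable.isOpen_one_lt {X : Type*} [MetricSpace X]
    [MeasurableSpace X] [BorelSpace X] {S : ComputableMetricSpace X}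
    {t : X × ProbabilityMeasure X → ℝ≥0∞} (ht : LowerSemicomputable S.prodBasis t) :
    IsOpen {p | 1 < t p} := by
  obtain ⟨G, -, hG⟩ := ht
  have h := hG (1, 0)
  rw [show (codedRat (1, 0) : ℝ≥0∞) = 1 by simp [codedRat]] at h
  rw [h]
  exact isOpen_biUnion fun b _ => S.isOpen_prodBasis b

theorem mainTheorem11 {X : Type*} [MetricSpace X] [CompactSpace X] [MeasurableSpace X]
    [BorelSpace X] (S : UniformRandomness.ComputableMetricSpace X)
    (t : X × ProbabilityMeasure X → ℝ≥0∞) (ht : S.IsUniversalUniformTest t) :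
    ∃ M : ProbabilityMeasure X, UniformRandomness.IsNeutral t M := by
  have : Nonempty X := ⟨S.α 0⟩
  refine exists_probabilityMeasure_forall_le_one t (fun x => ?_) fun μ => (ht.1.2 μ).2
  rw [← isOpen_compl_iff]
  convert ht.1.1.isOpen_one_lt.preimage (Continuous.prodMk_right x) using 1
  ext μ
  simp
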